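/- A fair coin is flipped $n$ times ($n\ge 0$). Each occurrence of $HH$ in consecutive positions (overlaps counted) gives Alice one point, and each occurrence of $HT$ in consecutive positions gives Bob one point. Let $\Delta_n$ be the probability that Bob has strictly more points than Alice, minus the probability that Alice has strictly more points than Bob. Let $S=\{(6,5),(0,1),(1,1),(3,3)\}\subset\mathbb{Z}_{\ge 0}^2$, and let $c_{(3,3)}=2$ and $c_s=1$ for every other $s\in S$. A colored lattice path is a finite (possibly empty) sequence of pairs $(s_i,x_i)$ with $s_i\in S$ and $x_i\in\{1,\dots,c_{s_i}\}$; its endpoint is $\sum_i s_i$. Let $N_{S,C}(a,b)$ denote the number of colored lattice paths with endpoint $(a,b)$. Then for every $n\ge 0$, $$\Delta_n=\frac{N_{S,C}(n,n)-1}{2^{n+1}}.$$ In particular, $\Delta_n>0$ for every $n\ge 3$. -/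

import Mathlib

open MeasureTheory

/-- The fair coin; `true` stands for heads (`H`) and `false` for tails (`T`). -/
noncomputable def fairCoin : Measure Bool := (PMF.uniformOfFintype Bool).toMeasure

/-- The law of `n` independent flips of a fair coin. -/
noncomputable def flipLaw (n : ℕ) : Measure (Fin n → Bool) := Measure.pi fun _ => fairCoin

/-- Alice's score: the number of (possibly overlapping) occurrences of `HH` at consecutive
positions in the sequence of flips. -/
def aliceScore {n : ℕ} (ω : Fin n → Bool) : ℕ :=
  (Finset.univ.filter fun p : Fin n × Fin n =>
    p.2.val = p.1.val + 1 ∧ ω p.1 = true ∧ ω p.2 = true).card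

/-- Bob's score: the number of occurrences of `HT` at consecutive positions. -/
def bobScore {n : ℕ} (ω : Fin n → Bool) : ℕ :=
  (Finset.univ.filter fun p : Fin n × Fin n =>
    p.2.val = p.1.val + 1 ∧ ω p.1 = true ∧ ω p.2 = false).card

/-- The probability that Bob has strictly more points than Alice after `n` flips. -/
noncomputable def probBob (n : ℕ) : ℝ :=
  (flipLaw n).real {ω | aliceScore ω < bobScore ω}

/-- The probability that Alice has strictly more points than Bob after `n` flips. -/
noncomputable def probAlice (n : ℕ) : ℝ :=
  (flipLaw n).real {ω | bobScore ω < aliceScore ω}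

/-- The difference `Δ_n` of the two winning probabilities. -/
noncomputable def winDifference (n : ℕ) : ℝ := probBob n - probAlice n

/-- A finite set `S` of nonzero steps in the non-negative plane lattice, together with a
positive number `c_s` of colors for every step `s` of `S`. -/
structure ColoredSteps where
  steps : Finset (ℕ × ℕ)
  zero_notMem : (0, 0) ∉ steps
  numColors : steps → ℕ
  numColors_pos : ∀ s, 1 ≤ numColors s

namespace ColoredSteps

/-- A step of `S` with one of its `c_s` colors. -/
abbrev ColoredStep (C : ColoredSteps) : Type := Σ s : C.steps, Fin (C.numColors s)

/-- A colored lattice path: a finite, possibly empty, sequence of colored steps. -/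
abbrev Path (C : ColoredSteps) : Type := List C.ColoredStep

/-- The endpoint of a colored lattice path: the sum of its steps in `ℤ²`. -/
def endpoint {C : ColoredSteps} (p : C.Path) : ℤ × ℤ :=
  (p.map fun x => ((x.1.val.1 : ℤ), (x.1.val.2 : ℤ))).sum

/-- The number `N_{S,C}(a, b)` of colored lattice paths with endpoint `(a, b)`. -/
noncomputable def pathCount (C : ColoredSteps) (a b : ℤ) : ℕ :=
  Set.ncard {p : C.Path | endpoint p = (a, b)}

/-- Only finitely many paths have a given endpoint, so `pathCount` is a true count. -/
theorem finite_paths (C : ColoredSteps) (a b : ℤ) :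
    {p : C.Path | endpoint p = (a, b)}.Finite := by
  have key : ∀ p : C.Path, (p.length : ℤ) ≤ (endpoint p).1 + (endpoint p).2 := by
    intro p
    induction p with
    | nil => simp [endpoint]
    | cons x p ih =>
      have hx : 1 ≤ x.1.val.1 + x.1.val.2 := by
        by_contra h
        have h0 : x.1.val = (0, 0) := Prod.ext (by simp; omega) (by simp; omega)
        exact C.zero_notMem (h0 ▸ x.1.property)
      simp only [endpoint, List.map_cons, List.sum_cons, Prod.fst_add, Prod.snd_add,
        List.length_cons] at ih ⊢
      push_cast
      omega
  refine (List.finite_length_le C.ColoredStep (a + b).toNat).subset ?_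
  intro p hp
  have h := key p
  rw [show endpoint p = (a, b) from hp] at h
  simp only [Set.mem_setOf_eq]
  omega

end ColoredSteps

/-- The steps `(6, 5)`, `(0, 1)`, `(1, 1)`, `(3, 3)`, where `(3, 3)` has two colors and every
other step has one. -/
def gameSteps : ColoredSteps where
  steps := {(6, 5), (0, 1), (1, 1), (3, 3)}
  zero_notMem := by decide
  numColors := fun s => if s.val = (3, 3) then 2 else 1
  numColors_pos := by intro s; split <;> norm_num

/-!
Write `Sₙ` for the sum of `sign (Bob - Alice)` over all words of `n` flips, so that
`Δₙ = Sₙ / 2 ^ n`, and let `Eₙ(d)` be the number of words ending in heads in which Bob leads by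
exactly `d`.

A further flip changes the lead `d` only after heads, and then to `d - 1` or to `d + 1`. The second
difference of `sign` is `1` at `-1`, `-1` at `1`, and `0` elsewhere, hence
`Sₙ₊₁ = 2 Sₙ + Eₙ(-1) - Eₙ(1)` (`signSum_succ`). The words ending in heads with `u` occurrences of
`HT` and `k` of `HH` number `C(u + k, k) C(n - 1 - u - k, u)` (`headsCount_eq`), which gives
`Eₙ₊₁(1) = Eₙ(1) + Eₙ(-1)` term by term (`headsLead_succ_one`). So `Eₙ(1)` satisfies the recursion of
`Sₙ`, and `Sₙ = Eₙ(1)` (`signSum_eq_headsLead`). Summing the closed form, and using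
`2 C(2k - 1, k - 1) = C(2k, k)`, one gets `2 Sₙ + 1 = ∑ₖ C(2k, k) C(n - 2k, k)`
(`two_mul_signSum`).

On the side of the paths, the linear coordinates `L = 3b - 2a` and `e = a - b` turn the steps
`(1, 1)`, `(6, 5)`, `(0, 1)`, `(3, 3)` into `(1, 0)`, `(3, 1)`, `(3, -1)` and, in two colors,
`(3, 0)`. The four colored steps with `L = 3` have generating function
`v + v⁻¹ + 2 = v⁻¹ (1 + v) ^ 2` in `e`. A path with `k` of them and `L - 3k` steps `(1, 1)` can
be arranged in `C(L - 2k, k)` ways, so there are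
`∑ₖ C(2k, k + e) C(L - 2k, k)` paths (`gameSteps_pathCount_sheared`). At the point `(n, n)`, where
`L = n` and `e = 0`, this is the sum found above.
-/

/-! ### Appending a flip -/

/-- The last flip exists and is heads. -/
def EndsInHeads {n : ℕ} (ω : Fin n → Bool) : Prop := ∃ i : Fin n, i.val + 1 = n ∧ ω i = true

instance {n : ℕ} (ω : Fin n → Bool) : Decidable (EndsInHeads ω) := by
  unfold EndsInHeads; infer_instance

theorem endsInHeads_snoc {n : ℕ} (ω : Fin n → Bool) (b : Bool) :
    EndsInHeads (Fin.snoc ω b : Fin (n + 1) → Bool) ↔ b = true := by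
  constructor
  · rintro ⟨i, hi, h⟩
    have : i = Fin.last n := Fin.ext (by simpa using hi)
    subst this
    simpa using h
  · intro h
    exact ⟨Fin.last n, by simp, by simpa using h⟩

/-- The common form of `aliceScore_snoc` (`c = true`) and `bobScore_snoc` (`c = false`). -/
theorem card_headsThen_snoc {n : ℕ} (ω : Fin n → Bool) (b c : Bool) :
    (Finset.univ.filter fun p : Fin (n + 1) × Fin (n + 1) =>
      p.2.val = p.1.val + 1 ∧ (Fin.snoc ω b : Fin (n + 1) → Bool) p.1 = true ∧
        (Fin.snoc ω b : Fin (n + 1) → Bool) p.2 = c).card =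
    (Finset.univ.filter fun p : Fin n × Fin n =>
      p.2.val = p.1.val + 1 ∧ ω p.1 = true ∧ ω p.2 = c).card +
      if EndsInHeads ω ∧ b = c then 1 else 0 := by
  simp only [Finset.card_filter, Fintype.sum_prod_type, Fin.sum_univ_castSucc (n := n),
    Fin.snoc_castSucc, Fin.snoc_last, Fin.val_castSucc, Fin.val_last, Finset.sum_add_distrib]
  -- No pair of positions starts at the appended flip.
  have h1 : ∀ j : Fin n, ¬ (j.val = n + 1) := fun j => by omega
  simp only [h1, false_and, if_false, Finset.sum_const_zero, add_zero, Nat.left_eq_add,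
    one_ne_zero]
  congr 1
  rcases n with _ | m
  · simp [EndsInHeads]
  · rw [Fin.sum_univ_castSucc, Finset.sum_eq_zero, zero_add]
    · refine if_congr ⟨?_, ?_⟩ rfl rfl
      · rintro ⟨-, h, h'⟩
        exact ⟨⟨Fin.last m, by simp, h⟩, h'⟩
      · rintro ⟨⟨i, hi, h⟩, h'⟩
        have : i = Fin.last m := Fin.ext (by simpa using hi)
        subst this
        exact ⟨by simp, h, h'⟩
    · intro i _
      rw [if_neg]
      rintro ⟨h, -⟩
      have := i.isLt
      simp at h
      omega

theorem aliceScore_snoc {n : ℕ} (ω : Fin n → Bool) (b : Bool) :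
    aliceScore (Fin.snoc ω b : Fin (n + 1) → Bool) =
      aliceScore ω + if EndsInHeads ω ∧ b = true then 1 else 0 :=
  card_headsThen_snoc ω b true

theorem bobScore_snoc {n : ℕ} (ω : Fin n → Bool) (b : Bool) :
    bobScore (Fin.snoc ω b : Fin (n + 1) → Bool) =
      bobScore ω + if EndsInHeads ω ∧ b = false then 1 else 0 :=
  card_headsThen_snoc ω b false

theorem sum_snoc {M : Type*} [AddCommMonoid M] {n : ℕ} (F : (Fin (n + 1) → Bool) → M) :
    ∑ ω, F ω = ∑ ω : Fin n → Bool, (F (Fin.snoc ω true) + F (Fin.snoc ω false)) := by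
  rw [← (Fin.snocEquiv fun _ => Bool).sum_comp, Fintype.sum_prod_type_right]
  simp [Fin.snocEquiv]

/-! ### Words with given numbers of `HT` and `HH` -/

/-- The number of words of length `n` ending in heads with `u` occurrences of `HT` and `k`
occurrences of `HH`. -/
def headsCount (n u k : ℕ) : ℕ :=
  ∑ ω : Fin n → Bool, if EndsInHeads ω ∧ bobScore ω = u ∧ aliceScore ω = k then 1 else 0

/-- The number of words of length `n`, empty or ending in tails, with `u` occurrences of `HT`
and `k` occurrences of `HH`. -/
def tailsCount (n u k : ℕ) : ℕ :=
  ∑ ω : Fin n → Bool, if ¬ EndsInHeads ω ∧ bobScore ω = u ∧ aliceScore ω = k then 1 else 0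

theorem headsCount_succ_zero (n u : ℕ) : headsCount (n + 1) u 0 = tailsCount n u 0 := by
  rw [headsCount, sum_snoc, tailsCount]
  refine Finset.sum_congr rfl fun ω _ => ?_
  by_cases h : EndsInHeads ω <;> simp [endsInHeads_snoc, aliceScore_snoc, bobScore_snoc, h]

theorem headsCount_succ_succ (n u k : ℕ) :
    headsCount (n + 1) u (k + 1) = headsCount n u k + tailsCount n u (k + 1) := by
  rw [headsCount, sum_snoc, tailsCount, headsCount, ← Finset.sum_add_distrib]
  refine Finset.sum_congr rfl fun ω _ => ?_
  by_cases h : EndsInHeads ω <;> simp [endsInHeads_snoc, aliceScore_snoc, bobScore_snoc, h]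

theorem tailsCount_succ_zero (n k : ℕ) : tailsCount (n + 1) 0 k = tailsCount n 0 k := by
  rw [tailsCount, sum_snoc, tailsCount]
  refine Finset.sum_congr rfl fun ω _ => ?_
  by_cases h : EndsInHeads ω <;> simp [endsInHeads_snoc, aliceScore_snoc, bobScore_snoc, h]

theorem tailsCount_succ_succ (n u k : ℕ) :
    tailsCount (n + 1) (u + 1) k = tailsCount n (u + 1) k + headsCount n u k := by
  rw [tailsCount, sum_snoc, tailsCount, headsCount, ← Finset.sum_add_distrib]
  refine Finset.sum_congr rfl fun ω _ => ?_
  by_cases h : EndsInHeads ω <;> simp [endsInHeads_snoc, aliceScore_snoc, bobScore_snoc, h]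

theorem headsCount_zero (u k : ℕ) : headsCount 0 u k = 0 := by
  simp [headsCount, EndsInHeads]

theorem tailsCount_zero (u k : ℕ) :
    tailsCount 0 u k = if u = 0 ∧ k = 0 then 1 else 0 := by
  simp [tailsCount, EndsInHeads, bobScore, aliceScore, eq_comm (a := 0)]

theorem tailsCount_zero_left (n k : ℕ) : tailsCount n 0 k = if k = 0 then 1 else 0 := by
  induction n with
  | zero => simp [tailsCount_zero]
  | succ n ih => rw [tailsCount_succ_zero, ih]

/-- Closed forms of both counts, proved together because their recursions are coupled. The guard
`u + k + 1 ≤ n` keeps the truncated subtraction `n - (u + k + 1)` from counting words that are too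
short. -/
theorem tailsCount_succ_and_headsCount (n : ℕ) : ∀ u k,
    tailsCount n (u + 1) k =
      (if u + k + 1 ≤ n then (u + k).choose k * (n - (u + k + 1)).choose (u + 1) else 0) ∧
    headsCount n u k =
      if u + k + 1 ≤ n then (u + k).choose k * (n - (u + k + 1)).choose u else 0 := by
  induction n with
  | zero => intro u k; simp [tailsCount_zero, headsCount_zero]
  | succ n ih =>
    intro u k
    constructor
    · rw [tailsCount_succ_succ, (ih u k).1, (ih u k).2]
      rcases lt_trichotomy n (u + k) with h | h | h
      · rw [if_neg (by omega), if_neg (by omega), if_neg (by omega)]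
      · rw [if_neg (by omega), if_neg (by omega), if_pos (by omega),
          show n + 1 - (u + k + 1) = 0 by omega]
        simp
      · rw [if_pos (by omega), if_pos (by omega), if_pos (by omega),
          show n + 1 - (u + k + 1) = (n - (u + k + 1)) + 1 by omega, Nat.choose_succ_succ]
        ring
    · rcases k with _ | k
      · rw [headsCount_succ_zero]
        rcases u with _ | u
        · simp [tailsCount_zero_left]
        · rw [(ih u 0).1]
          simp only [add_zero, Nat.choose_zero_right, one_mul]
          rcases lt_trichotomy n (u + 1) with h | h | h
          · rw [if_neg (by omega), if_neg (by omega)]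
          · subst h; simp
          · rw [if_pos (by omega), if_pos (by omega), Nat.add_sub_add_right]
      · rw [headsCount_succ_succ, (ih u k).2]
        rcases u with _ | u
        · simp [tailsCount_zero_left]
        · rw [(ih u (k + 1)).1]
          rcases Nat.lt_or_ge n (u + k + 2) with h | h
          · rw [if_neg (by omega), if_neg (by omega), if_neg (by omega)]
          · rw [if_pos (by omega), if_pos (by omega), if_pos (by omega),
              show u + 1 + (k + 1) = (u + k + 1) + 1 by omega, Nat.choose_succ_succ,
              show u + 1 + k = u + k + 1 by omega, show u + (k + 1) = u + k + 1 by omega,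
              show n + 1 - (u + k + 1 + 1 + 1) = n - (u + k + 1 + 1 ) by omega]
            ring

theorem headsCount_eq (n u k : ℕ) : headsCount n u k =
    if u + k + 1 ≤ n then (u + k).choose k * (n - (u + k + 1)).choose u else 0 :=
  (tailsCount_succ_and_headsCount n u k).2

/-- The termwise form of `Eₙ₊₁(1) = Eₙ(1) + Eₙ(-1)`: Pascal's rule for the second binomial
coefficient, and the symmetry of the middle binomial coefficients for the first. -/
theorem headsCount_succ_self (n k : ℕ) :
    headsCount (n + 1) (k + 1) k = headsCount n (k + 1) k + headsCount n k (k + 1) := by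
  have hc : (k + 1 + k).choose k = (k + (k + 1)).choose (k + 1) := by
    rw [show k + 1 + k = 2 * k + 1 by ring, show k + (k + 1) = 2 * k + 1 by ring,
      Nat.choose_symm_half]
  simp only [headsCount_eq, ← hc]
  rcases lt_trichotomy n (2 * k + 1) with h | h | h
  · rw [if_neg (by omega), if_neg (by omega), if_neg (by omega)]
  · rw [if_pos (by omega), if_neg (by omega), if_neg (by omega),
      show n + 1 - (k + 1 + k + 1) = 0 by omega]
    simp
  · rw [if_pos (by omega), if_pos (by omega), if_pos (by omega),
      show n + 1 - (k + 1 + k + 1) = (n - (k + 1 + k + 1)) + 1 by omega, Nat.choose_succ_succ,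
      show k + (k + 1) + 1 = k + 1 + k + 1 by omega]
    ring

/-! ### The difference of the numbers of wins -/

/-- The number of words of length `n` ending in heads in which Bob's lead is exactly `d`. -/
def headsLead (n : ℕ) (d : ℤ) : ℤ :=
  ∑ ω : Fin n → Bool, if EndsInHeads ω ∧ (bobScore ω : ℤ) - aliceScore ω = d then 1 else 0

/-- The number of words in which Bob wins minus the number of words in which Alice wins. -/
def signSum (n : ℕ) : ℤ := ∑ ω : Fin n → Bool, ((bobScore ω : ℤ) - aliceScore ω).sign

theorem signSum_succ (n : ℕ) :
    signSum (n + 1) = 2 * signSum n + headsLead n (-1) - headsLead n 1 := by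
  rw [signSum, sum_snoc, signSum, headsLead, headsLead, Finset.mul_sum, ← Finset.sum_add_distrib,
    ← Finset.sum_sub_distrib]
  refine Finset.sum_congr rfl fun ω _ => ?_
  -- The second difference of the sign function.
  have key : ∀ d : ℤ, (d - 1).sign + (d + 1).sign =
      2 * d.sign + (if d = -1 then 1 else 0) - (if d = 1 then 1 else 0) := by
    intro d
    rcases lt_trichotomy d 0 with h | rfl | h
    · obtain rfl | h' : d = -1 ∨ d < -1 := by omega
      · decide
      · rw [Int.sign_eq_neg_one_of_neg h, Int.sign_eq_neg_one_of_neg (by omega),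
          Int.sign_eq_neg_one_of_neg (by omega), if_neg (by omega), if_neg (by omega)]
        norm_num
    · decide
    · obtain rfl | h' : d = 1 ∨ 1 < d := by omega
      · decide
      · rw [Int.sign_eq_one_of_pos h, Int.sign_eq_one_of_pos (by omega),
          Int.sign_eq_one_of_pos (by omega), if_neg (by omega), if_neg (by omega)]
        norm_num
  by_cases h : EndsInHeads ω
  · simp only [aliceScore_snoc, bobScore_snoc, h, true_and, reduceCtorEq, if_true, if_false,
      Nat.cast_add, Nat.cast_one, add_zero, ← key]
    congr 2 <;> ring
  · simp only [aliceScore_snoc, bobScore_snoc, h, false_and, if_false, add_zero, sub_zero]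
    ring

theorem aliceScore_le {n : ℕ} (ω : Fin n → Bool) : aliceScore ω ≤ n := by
  induction n with
  | zero => simp [aliceScore]
  | succ n ih =>
    rw [← Fin.snoc_init_self ω, aliceScore_snoc]
    have := ih (Fin.init ω)
    split_ifs <;> omega

theorem bobScore_le {n : ℕ} (ω : Fin n → Bool) : bobScore ω ≤ n := by
  induction n with
  | zero => simp [bobScore]
  | succ n ih =>
    rw [← Fin.snoc_init_self ω, bobScore_snoc]
    have := ih (Fin.init ω)
    split_ifs <;> omega

theorem headsLead_one (n N : ℕ) (h : n < N) :
    headsLead n 1 = ∑ k ∈ Finset.range N, (headsCount n (k + 1) k : ℤ) := by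
  simp only [headsLead, headsCount, Nat.cast_sum]
  rw [Finset.sum_comm]
  refine Finset.sum_congr rfl fun ω _ => ?_
  have ha := aliceScore_le ω
  rw [Finset.sum_eq_single (aliceScore ω)]
  · push_cast
    refine if_congr (and_congr_right fun _ => ?_) rfl rfl
    omega
  · intro k _ hk
    rw [if_neg (by tauto)]; rfl
  · intro hk; simp at hk; omega

theorem headsLead_neg_one (n N : ℕ) (h : n < N) :
    headsLead n (-1) = ∑ k ∈ Finset.range N, (headsCount n k (k + 1) : ℤ) := by
  simp only [headsLead, headsCount, Nat.cast_sum]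
  rw [Finset.sum_comm]
  refine Finset.sum_congr rfl fun ω _ => ?_
  have ha := bobScore_le ω
  rw [Finset.sum_eq_single (bobScore ω)]
  · push_cast
    refine if_congr (and_congr_right fun _ => ?_) rfl rfl
    omega
  · intro k _ hk
    rw [if_neg (by tauto)]; rfl
  · intro hk; simp at hk; omega

theorem headsLead_succ_one (n : ℕ) : headsLead (n + 1) 1 = headsLead n 1 + headsLead n (-1) := by
  rw [headsLead_one (n + 1) (n + 2) (by omega), headsLead_one n (n + 2) (by omega),
    headsLead_neg_one n (n + 2) (by omega), ← Finset.sum_add_distrib]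
  refine Finset.sum_congr rfl fun k _ => ?_
  rw [headsCount_succ_self]; push_cast; rfl

theorem signSum_eq_headsLead (n : ℕ) : signSum n = headsLead n 1 := by
  induction n with
  | zero => simp [signSum, headsLead, bobScore, aliceScore]
  | succ n ih => rw [signSum_succ, headsLead_succ_one, ih]; ring

/-- The summand `k = 0` on the right is the `1` on the left; the summand `k + 1` is twice the number
of words ending in heads with `k + 1` occurrences of `HT` and `k` of `HH`. -/
theorem two_mul_signSum (n N : ℕ) (h : n < N) :
    2 * signSum n + 1 = ∑ k ∈ Finset.range N,
      if 3 * k ≤ n then ((2 * k).choose k * (n - 2 * k).choose k : ℤ) else 0 := by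
  obtain ⟨N, rfl⟩ : ∃ M, N = M + 1 := ⟨N - 1, by omega⟩
  rw [signSum_eq_headsLead, headsLead_one n (N + 1) h, Finset.sum_range_succ,
    Finset.sum_range_succ']
  rw [headsCount_eq, if_neg (by omega), Nat.cast_zero, add_zero, Finset.mul_sum]
  congr 1
  · refine Finset.sum_congr rfl fun k _ => ?_
    rw [headsCount_eq]
    have hc : (2 * (k + 1)).choose (k + 1) = 2 * (k + 1 + k).choose k := by
      rw [show 2 * (k + 1) = 2 * k + 1 + 1 by ring, Nat.choose_succ_succ, Nat.choose_symm_half,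
        show k + 1 + k = 2 * k + 1 by ring]
      ring
    rw [hc, show k + 1 + k + 1 = 2 * (k + 1) by ring]
    by_cases h3 : 3 * (k + 1) ≤ n
    · rw [if_pos (by omega), if_pos h3]; push_cast; ring
    · rw [if_neg h3]
      split_ifs
      · rw [Nat.choose_eq_zero_of_lt (show n - 2 * (k + 1) < k + 1 by omega)]; simp
      · simp
  · simp

/-! ### From probabilities to counting -/

theorem flipLaw_real_singleton (n : ℕ) (ω : Fin n → Bool) :
    (flipLaw n).real {ω} = 1 / 2 ^ n := by
  have : IsProbabilityMeasure fairCoin := by unfold fairCoin; infer_instance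
  have hb : ∀ b : Bool, fairCoin {b} = 2⁻¹ := by
    intro b
    rw [fairCoin, PMF.toMeasure_apply_singleton _ _ (measurableSet_singleton b)]
    simp
  rw [Measure.real, flipLaw, Measure.pi_singleton]
  simp [hb]

theorem winDifference_eq (n : ℕ) : winDifference n = (signSum n : ℝ) / 2 ^ n := by
  have : IsProbabilityMeasure fairCoin := by unfold fairCoin; infer_instance
  have : IsProbabilityMeasure (flipLaw n) := by unfold flipLaw; infer_instance
  have hsum : ∀ (P : (Fin n → Bool) → Prop) [DecidablePred P],
      (flipLaw n).real {ω | P ω} = (∑ ω, if P ω then (1 : ℝ) else 0) / 2 ^ n := by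
    intro P _
    rw [← Finset.coe_filter_univ, ← sum_measureReal_singleton]
    simp only [flipLaw_real_singleton]
    rw [← Finset.sum_filter, Finset.sum_div]
  rw [winDifference, probBob, probAlice, hsum, hsum, ← sub_div, ← Finset.sum_sub_distrib, signSum,
    Int.cast_sum]
  congr 1
  refine Finset.sum_congr rfl fun ω _ => ?_
  rcases lt_trichotomy (aliceScore ω) (bobScore ω) with h | h | h
  · rw [if_pos h, if_neg (by omega), Int.sign_eq_one_of_pos (by omega)]; simp
  · simp [h]
  · rw [if_neg (by omega), if_pos h, Int.sign_eq_neg_one_of_neg (by omega)]; simp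

/-! ### Lattice paths by their first step -/

namespace ColoredSteps

theorem endpoint_cons {C : ColoredSteps} (x : C.ColoredStep) (p : C.Path) :
    endpoint (x :: p) = ((x.1.val.1 : ℤ), (x.1.val.2 : ℤ)) + endpoint p := by
  simp [endpoint]

/-- Removing the first step, a path to `(a, b)` is empty or a step followed by a path to the
remaining displacement. -/
def pathsEquiv (C : ColoredSteps) (a b : ℤ) :
    {p : C.Path // endpoint p = (a, b)} ≃
      PLift ((a, b) = ((0, 0) : ℤ × ℤ)) ⊕
        Σ x : C.ColoredStep, {p : C.Path // endpoint p = (a - x.1.val.1, b - x.1.val.2)} where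
  toFun
    | ⟨[], h⟩ => Sum.inl ⟨by rw [← h]; rfl⟩
    | ⟨x :: p, h⟩ => Sum.inr ⟨x, p, by
        rw [endpoint_cons] at h
        rw [eq_comm, ← sub_eq_iff_eq_add'] at h
        rw [← h]; rfl⟩
  invFun
    | Sum.inl h => ⟨[], by rw [h.down]; rfl⟩
    | Sum.inr ⟨x, p, h⟩ => ⟨x :: p, by rw [endpoint_cons, h]; simp⟩
  left_inv := by rintro ⟨_ | ⟨x, p⟩, h⟩ <;> rfl
  right_inv := by rintro (⟨h⟩ | ⟨x, p, h⟩) <;> rfl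

theorem pathCount_eq_sum (C : ColoredSteps) (a b : ℤ) :
    C.pathCount a b = (if a = 0 ∧ b = 0 then 1 else 0) +
      ∑ s : C.steps, C.numColors s * C.pathCount (a - s.val.1) (b - s.val.2) := by
  have hfin : ∀ a b : ℤ, Finite {p : C.Path // endpoint p = (a, b)} := fun a b =>
    (C.finite_paths a b).to_subtype
  have hc : ∀ a b : ℤ, C.pathCount a b = Nat.card {p : C.Path // endpoint p = (a, b)} :=
    fun a b => rfl
  rw [hc, Nat.card_congr (C.pathsEquiv a b), Nat.card_sum, Nat.card_sigma, Fintype.sum_sigma]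
  congr 1
  · split_ifs with h
    · have : Unique (PLift ((a, b) = ((0, 0) : ℤ × ℤ))) :=
        ⟨⟨⟨by rw [h.1, h.2]⟩⟩, fun _ => rfl⟩
      exact Nat.card_unique
    · have : IsEmpty (PLift ((a, b) = ((0, 0) : ℤ × ℤ))) :=
        ⟨fun h' => h (by simpa using h'.down)⟩
      exact Nat.card_of_isEmpty
  · refine Finset.sum_congr rfl fun s _ => ?_
    simp [hc]

end ColoredSteps

open ColoredSteps in
theorem gameSteps_pathCount (a b : ℤ) :
    gameSteps.pathCount a b = (if a = 0 ∧ b = 0 then 1 else 0) +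
      (gameSteps.pathCount (a - 6) (b - 5) + gameSteps.pathCount a (b - 1) +
        gameSteps.pathCount (a - 1) (b - 1) + 2 * gameSteps.pathCount (a - 3) (b - 3)) := by
  rw [pathCount_eq_sum]
  congr 1
  have : ∀ s : gameSteps.steps, gameSteps.numColors s * gameSteps.pathCount (a - s.val.1)
      (b - s.val.2) = (fun s : ℕ × ℕ => (if s = (3, 3) then 2 else 1) *
        gameSteps.pathCount (a - s.1) (b - s.2)) s.val := fun s => rfl
  simp only [this]
  rw [Finset.sum_coe_sort gameSteps.steps (fun s : ℕ × ℕ => (if s = (3, 3) then 2 else 1) *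
        gameSteps.pathCount (a - s.1) (b - s.2))]
  simp [gameSteps, add_assoc]

/-- Every step has `3b - 2a > 0`, so this form is nonnegative at every endpoint. -/
theorem gameSteps_pathCount_of_neg (a b : ℤ) (h : 3 * b - 2 * a < 0) :
    gameSteps.pathCount a b = 0 := by
  have key : ∀ p : gameSteps.Path,
      0 ≤ 3 * (ColoredSteps.endpoint p).2 - 2 * (ColoredSteps.endpoint p).1 := by
    intro p
    induction p with
    | nil => simp [ColoredSteps.endpoint]
    | cons x p ih =>
      rw [ColoredSteps.endpoint_cons]
      have hx : x.1.val ∈ ({(6, 5), (0, 1), (1, 1), (3, 3)} : Finset (ℕ × ℕ)) := x.1.property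
      simp only [Finset.mem_insert, Finset.mem_singleton] at hx
      rcases hx with hx | hx | hx | hx <;> rw [hx] <;> simp <;> omega
  rw [ColoredSteps.pathCount, Set.ncard_eq_zero (gameSteps.finite_paths a b),
    Set.eq_empty_iff_forall_notMem]
  intro p hp
  have hp : ColoredSteps.endpoint p = (a, b) := hp
  have := key p
  rw [hp] at this
  simp at this
  omega

/-! ### The closed form of the path count -/

/-- The binomial coefficient with integer lower index, zero when that index is negative. -/
def chooseInt (m : ℕ) (j : ℤ) : ℕ := if 0 ≤ j then m.choose j.toNat else 0

theorem chooseInt_zero (j : ℤ) : chooseInt 0 j = if j = 0 then 1 else 0 := by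
  unfold chooseInt
  rcases lt_trichotomy j 0 with h | rfl | h
  · rw [if_neg (by omega), if_neg (by omega)]
  · simp
  · rw [if_pos (by omega), if_neg (by omega), Nat.choose_eq_zero_of_lt (by omega)]

theorem chooseInt_succ (m : ℕ) (j : ℤ) :
    chooseInt (m + 1) j = chooseInt m j + chooseInt m (j - 1) := by
  unfold chooseInt
  rcases lt_trichotomy j 0 with h | rfl | h
  · rw [if_neg (by omega), if_neg (by omega), if_neg (by omega)]
  · simp
  · obtain ⟨i, rfl⟩ : ∃ i : ℕ, j = i + 1 := ⟨(j - 1).toNat, by omega⟩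
    rw [if_pos (by omega), if_pos (by omega), if_pos (by omega),
      show ((i : ℤ) + 1).toNat = i + 1 by omega, show ((i : ℤ) + 1 - 1).toNat = i by omega,
      Nat.choose_succ_succ, Nat.add_comm]

/-- The number of ways to write `L` as an ordered sum of ones and of exactly `k` threes; it is zero
for `L < 3k`, in particular for negative `L`. -/
def arrangements (L : ℤ) (k : ℕ) : ℕ :=
  if 3 * (k : ℤ) ≤ L then (L.toNat - 2 * k).choose k else 0

theorem arrangements_zero (L : ℤ) :
    arrangements L 0 = (if L = 0 then 1 else 0) + arrangements (L - 1) 0 := by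
  simp only [arrangements, Nat.choose_zero_right]
  split_ifs <;> omega

theorem arrangements_succ (L : ℤ) (k : ℕ) :
    arrangements L (k + 1) = arrangements (L - 1) (k + 1) + arrangements (L - 3) k := by
  unfold arrangements
  rcases lt_trichotomy L (3 * k + 3) with h | rfl | h
  · rw [if_neg (by omega), if_neg (by omega), if_neg (by omega)]
  · rw [if_pos (by omega), if_neg (by omega), if_pos (by omega),
      show (3 * (k : ℤ) + 3).toNat - 2 * (k + 1) = k + 1 by omega,
      show (3 * (k : ℤ) + 3 - 3).toNat - 2 * k = k by omega]
    simp
  · obtain ⟨m, rfl⟩ : ∃ m : ℕ, L = m + (3 * k + 4) := ⟨(L - (3 * k + 4)).toNat, by omega⟩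
    rw [if_pos (by omega), if_pos (by omega), if_pos (by omega),
      show ((m : ℤ) + (3 * k + 4)).toNat - 2 * (k + 1) = (m + k + 1) + 1 by omega,
      show ((m : ℤ) + (3 * k + 4) - 1).toNat - 2 * (k + 1) = m + k + 1 by omega,
      show ((m : ℤ) + (3 * k + 4) - 3).toNat - 2 * k = m + k + 1 by omega,
      Nat.choose_succ_succ, Nat.add_comm]

/-- The closed form of the number of paths in the coordinates `L = 3b - 2a`, `e = a - b`, summed
over the number `k` of steps other than `(1, 1)`. Only `3k ≤ L` contributes, so the bound `N` of the
summation does not matter when `L < N`; fixing it once keeps the recursion free of boundary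
changes. -/
def shearedCount (N : ℕ) (L e : ℤ) : ℕ :=
  ∑ k ∈ Finset.range N, chooseInt (2 * k) (k + e) * arrangements L k

/-- The recursion of the path count by its first step, in sheared coordinates. -/
theorem shearedCount_eq_add (N : ℕ) (L e : ℤ) (h : L < N) :
    shearedCount N L e = (if L = 0 ∧ e = 0 then 1 else 0) + (shearedCount N (L - 1) e +
      (shearedCount N (L - 3) (e - 1) + shearedCount N (L - 3) (e + 1) +
        2 * shearedCount N (L - 3) e)) := by
  rcases N with _ | N
  · simp [shearedCount]; omega
  have htop : arrangements (L - 3) N = 0 := by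
    unfold arrangements
    rw [if_neg]
    push_cast at h
    omega
  have hdrop : ∀ e, shearedCount (N + 1) (L - 3) e = shearedCount N (L - 3) e := by
    intro e
    rw [shearedCount, Finset.sum_range_succ, htop, mul_zero, add_zero, shearedCount]
  -- Pascal's rule twice: one more factor `v⁻¹ (1 + v) ^ 2 = v + v⁻¹ + 2`.
  have hc : ∀ k : ℕ, chooseInt (2 * (k + 1)) (((k + 1 : ℕ) : ℤ) + e) =
      chooseInt (2 * k) (k + (e - 1)) + chooseInt (2 * k) (k + (e + 1)) +
        2 * chooseInt (2 * k) (k + e) := by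
    intro k
    rw [show 2 * (k + 1) = 2 * k + 1 + 1 by ring, chooseInt_succ, chooseInt_succ, chooseInt_succ,
      show ((k + 1 : ℕ) : ℤ) + e = k + (e + 1) by push_cast; ring,
      show (k : ℤ) + (e + 1) - 1 = k + e by ring, show (k : ℤ) + e - 1 = k + (e - 1) by ring]
    ring
  have h0 : chooseInt (2 * 0) (((0 : ℕ) : ℤ) + e) = if e = 0 then 1 else 0 := by
    simp [chooseInt_zero]
  rw [hdrop, hdrop, hdrop]
  unfold shearedCount
  rw [Finset.sum_range_succ', Finset.sum_range_succ', h0, arrangements_zero]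
  have hs : ∀ k : ℕ, chooseInt (2 * (k + 1)) (((k + 1 : ℕ) : ℤ) + e) * arrangements L (k + 1) =
      chooseInt (2 * (k + 1)) (((k + 1 : ℕ) : ℤ) + e) * arrangements (L - 1) (k + 1) +
        (chooseInt (2 * k) (k + (e - 1)) * arrangements (L - 3) k +
          chooseInt (2 * k) (k + (e + 1)) * arrangements (L - 3) k +
          2 * (chooseInt (2 * k) (k + e) * arrangements (L - 3) k)) := by
    intro k
    rw [arrangements_succ L, mul_add, hc]
    ring
  simp only [hs, Finset.sum_add_distrib, ← Finset.mul_sum]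
  have : ((if e = 0 then 1 else 0) * if L = 0 then 1 else 0) =
      if L = 0 ∧ e = 0 then 1 else 0 := by split_ifs <;> simp_all
  rw [mul_add, this]
  ring

theorem gameSteps_pathCount_sheared (N : ℕ) (m : ℕ) (hm : m < N) (e : ℤ) :
    gameSteps.pathCount (m + 3 * e) (m + 2 * e) = shearedCount N m e := by
  have hneg : ∀ L e : ℤ, L < 0 → gameSteps.pathCount (L + 3 * e) (L + 2 * e) =
      shearedCount N L e := by
    intro L e hL
    rw [gameSteps_pathCount_of_neg _ _ (by linarith), shearedCount, eq_comm]
    refine Finset.sum_eq_zero fun k _ => ?_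
    rw [arrangements, if_neg (by omega), mul_zero]
  induction m using Nat.strong_induction_on generalizing e with
  | _ m ih =>
  have ih' : ∀ L e : ℤ, L < m → gameSteps.pathCount (L + 3 * e) (L + 2 * e) =
      shearedCount N L e := by
    intro L e hL
    rcases lt_or_ge L 0 with h | h
    · exact hneg L e h
    · lift L to ℕ using h
      exact ih L (by omega) (by omega) e
  rw [gameSteps_pathCount, shearedCount_eq_add N m e (by omega), ← ih' _ _ (by omega),
    ← ih' _ _ (by omega), ← ih' _ _ (by omega), ← ih' _ _ (by omega)]
  have hz : ((m : ℤ) + 3 * e = 0 ∧ (m : ℤ) + 2 * e = 0) ↔ ((m : ℤ) = 0 ∧ e = 0) := by omega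
  simp only [hz]
  ring_nf

theorem gameSteps_pathCount_diagonal (n N : ℕ) (h : n < N) :
    (gameSteps.pathCount n n : ℤ) = ∑ k ∈ Finset.range N,
      if 3 * k ≤ n then ((2 * k).choose k * (n - 2 * k).choose k : ℤ) else 0 := by
  have := gameSteps_pathCount_sheared N n h 0
  simp only [mul_zero, add_zero] at this
  rw [this, shearedCount]
  push_cast
  refine Finset.sum_congr rfl fun k _ => ?_
  simp only [chooseInt, arrangements]
  by_cases h3 : 3 * k ≤ n
  · rw [if_pos (by omega), if_pos (by omega), if_pos h3]
    simp
  · rw [if_neg (show ¬ 3 * (k : ℤ) ≤ n by omega), if_neg h3]; simp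

/-! ### The formula for the difference and its sign -/

theorem mainTheorem3 :
    (∀ n : ℕ, winDifference n = ((gameSteps.pathCount n n : ℝ) - 1) / 2 ^ (n + 1)) ∧
      ∀ n : ℕ, 3 ≤ n → 0 < winDifference n := by
  constructor
  · intro n
    have h := two_mul_signSum n (n + 1) (by omega)
    rw [← gameSteps_pathCount_diagonal n (n + 1) (by omega)] at h
    have h' : (gameSteps.pathCount n n : ℝ) = 2 * (signSum n : ℝ) + 1 := by exact_mod_cast h.symm
    rw [winDifference_eq, h', pow_succ]
    field_simp
    ring
  · intro n hn
    rw [winDifference_eq, signSum_eq_headsLead, headsLead_one n (n + 1) (by omega)]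
    refine div_pos ?_ (by positivity)
    -- The words with one `HT`, no `HH` and a final `H` number `n - 2`.
    have : (0 : ℤ) < ∑ k ∈ Finset.range (n + 1), (headsCount n (k + 1) k : ℤ) := by
      refine Finset.sum_pos' (fun _ _ => by positivity) ⟨0, by simp, ?_⟩
      rw [headsCount_eq, if_pos (by omega)]
      simp
      omega
    exact_mod_cast this
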